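/- Let $\mathbb{F}_q$ be a finite field of characteristic $>3$ and let $\mathcal{E}: By^2=x(x^2+Ax+1)$, with $B\neq0$ and $A^2\ne4$, be an elliptic curve in Montgomery form over $\mathbb{F}_q$, with group law $\oplus$ and zero the point at infinity $0$. Let $x(\cdot)$ be the $x$-coordinate map $\mathcal E\to\mathcal E/\langle\pm1\rangle=\mathbb P^1$, written in projective coordinates $(X:Z)$, with $x(0)=(1:0)$; a value is normalized if it is given as an affine coordinate or as $\infty$. Input and output points are given by affine coordinates or as $0$. Write $\mathbf M,\mathbf S,\mathbf I,\mathbf a$ for one multiplication, squaring, inversion, and addition or subtraction in $\mathbb F_q$, $\mathbf m_A$ for one multiplication by the constant $A$ or $(A+2)/4$, and $\mathbf m_B$ for one multiplication by the constant $B$ (such a product may instead be performed, and counted, as an $\mathbf M$). Equality tests, copies, and operations on the bits of $m$ and $n$ are not counted. Bounds on operation counts hold for each kind of operation separately. Subroutines (with normalized differences). Let $s=X+Z$, $d=X-Z$ for $(X:Z)=x(P)$, and $s'=X'+Z'$, $d'=X'-Z'$ for $(X':Z')=x(Q)$. - $\mathtt{xDBL}(x(P))=x([2]P)$, computed as $(s^2d^2: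 c\,(d^2+\tfrac{A+2}{4}c))$ with $c=s^2-d^2$. - $\mathtt{xADD}(x(P),x(Q),\delta)=x(P\oplus Q)$, where $\delta=x(P\ominus Q)$, computed as $((ds'+sd')^2:\delta\,(ds'-sd')^2)$ if $\delta\notin\{0,\infty\}$; it is $x([2]P)$ if $\delta=\infty$, and $x([2]P)$ with its two coordinates exchanged if $\delta=0$. - $\mathtt{xDBLADD}(x(P),x(Q),x(Q\ominus P))=(x([2]P),x(P\oplus Q))$, computed by the same formulas with $s$ and $d$ shared. - $\mathtt{Recover}(P,x(Q),x(Q\oplus P))=Q$ for $P=(x_P,y_P)\notin\mathcal E[2]$. With $x(Q)=(X_1:Z_1)$ and $x(Q\oplus P)=(X_2:Z_2)$, it is $0$ if $Z_1=0$, it is $\ominus P$ if $Z_1\ne0=Z_2$, and otherwise it is $(X/Z,Y/Z)$ with $X=2By_PZ_1Z_2X_1$, $Z=2By_PZ_1Z_2Z_1$, $Y=Z_2\big((x_PX_1+Z_1)(X_1+x_PZ_1+2AZ_1)-2AZ_1^2\big)-X_2(X_1-x_PZ_1)^2$. - $\mathtt{AddSub}(P,Q)=(P\oplus Q,\,x(P\ominus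 Q))$, both normalized, for $P,Q\notin\mathcal E[2]$: if $x_P\ne x_Q$, both come from the chord formulas with slopes $(\pm y_Q-y_P)/(x_Q-x_P)$ and one shared inversion; if $Q=\pm P$, from the tangent at $P$. Algorithm 1 (input: $m\geq1$ of bitlength $\beta$, with bits $m_i$, and $P$). Set $(t_1,t_2)\gets(x(P),\mathtt{xDBL}(x(P)))$. For $i=\beta-2$ down to $0$: if $m_i=0$, set $(t_1,t_2)\gets\mathtt{xDBLADD}(t_1,t_2,x(P))$; otherwise set $(t_2,t_1)\gets\mathtt{xDBLADD}(t_2,t_1,x(P))$. Return $\mathtt{Recover}(P,t_1,t_2)$. Algorithm 3 (input: $m,n\ge1$ with $\beta$ the bitlength of $\max(m,n)$, with bits $m_i,n_i$, and $P,Q$). Below, sums $+$ and products of bits are taken modulo $2$. Let $d_0=m_0$ and $d_{i+1}=(d_i+1)(m_i+m_{i+1})+d_i(n_i+n_{i+1}+1)$, and let $c_i=(m_{i+1}+n_{i+1},\,m_i+m_{i+1},\,n_i+n_{i+1},\,d_i)$ for $0\le i\le\beta-2$. Compute $(S,x_\ominus)\gets\mathtt{AddSub}(P,Q)$, and put $x_P=x(P)$,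 $x_Q=x(Q)$, $x_\oplus=x(S)$. According to $(m_{\beta-1},n_{\beta-1},d_{\beta-1})$, initialize $O,E,M$ by: - $(0,1,0)$: $M\gets x_Q$, $(E,O)\gets\mathtt{xDBLADD}(x_Q,x_P,x_\ominus)$; - $(1,0,1)$: $M\gets x_P$, $(E,O)\gets\mathtt{xDBLADD}(x_P,x_Q,x_\ominus)$; - in the other cases $O\gets x_\oplus$, and $(E,M)\gets\mathtt{xDBLADD}(\cdot)$ with arguments $(x_Q,x_\oplus,x_P)$ for $(0,1,1)$, $(x_P,x_\oplus,x_Q)$ for $(1,0,0)$, $(x_\oplus,x_P,x_Q)$ for $(1,1,0)$, and $(x_\oplus,x_Q,x_P)$ for $(1,1,1)$. For $i=\beta-2$ down to $0$, with $c_i=(c,c',c'',d)$, set in parallel $O\gets\mathtt{xADD}(O,E,\delta)$ and $(E,M)\gets\mathtt{xDBLADD}(U,V,\delta')$. Here $\delta=x_\oplus$ if $c=0$ and $\delta=x_\ominus$ if $c=1$; $\delta'=x_Q$ if $d=0$ and $\delta'=x_P$ if $d=1$. The pair $(U,V)$ is $(E,M)$ if $(c',c'')=(0,0)$; $(O,M)$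 if $(c',c'')=(1,1)$; $(M,E)$ if $(c',c'',d)$ is $(0,1,0)$ or $(1,0,1)$; and $(M,O)$ if it is $(0,1,1)$ or $(1,0,0)$. Finally, according to $(m_0,n_0)$, return $\mathtt{Recover}(S,E,O)$ for $(0,0)$, $\mathtt{Recover}(P,M,O)$ for $(0,1)$, $\mathtt{Recover}(P,M,E)$ for $(1,0)$, and $\mathtt{Recover}(S,O,E)$ for $(1,1)$. **Theorem.** 1. Let $P\in\mathcal E(\mathbb F_q)\setminus\mathcal E[2]$ and let $m$ be a positive integer of bitlength $\beta$. Then Algorithm 1 computes $[m]P$ in at most $$(5\beta+10)\mathbf M+(4\beta+2)\mathbf S+(\beta+1)\mathbf m_A+1\mathbf m_B+(8\beta+6)\mathbf a+1\mathbf I.$$ 2. Let $P,Q\in\mathcal E(\mathbb F_q)\setminus\mathcal E[2]$, let $m,n$ be positive integers, and let $\beta$ be the bitlength of $\max(m,n)$. If $m\equiv n\pmod 2$, assume also that $P\oplus Q\notin\mathcal E[2]$. Then Algorithm 3 computes $[m]P\oplus[n]Q$ in at most $$(8\beta+14)\mathbf M+(6\beta+2)\mathbf S+(\beta+1)\mathbf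 m_A+1\mathbf m_B+(14\beta+13)\mathbf a+2\mathbf I.$$ -/

import Mathlib

/-- An elliptic curve in Montgomery form `B y² = x (x² + A x + 1)` over a field of
characteristic `> 3`. -/
structure MontgomeryCurve (F : Type*) [Field F] where
  A : F
  B : F
  three_lt_char : 3 < ringChar F
  B_ne_zero : B ≠ 0
  A_sq_ne_four : A ^ 2 ≠ 4

namespace MontgomeryCurve

variable {F : Type*} [Field F]

theorem two_ne_zero' (E : MontgomeryCurve F) : (2 : F) ≠ 0 := by
  have h := E.three_lt_char
  exact Ring.two_ne_zero (by omega)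

/-- The rational points: the point at infinity, and the affine solutions. -/
inductive Point (E : MontgomeryCurve F) : Type _
  | infinity : Point E
  | affine (x y : F) (h : E.B * y ^ 2 = x * (x ^ 2 + E.A * x + 1)) : Point E

/-- The Weierstrass model `v² = u³ + A B u² + B² u`, to which the linear change of coordinates
`u = B x`, `v = B² y` takes the Montgomery model. -/
def weierstrass (E : MontgomeryCurve F) : WeierstrassCurve.Affine F where
  a₁ := 0
  a₂ := E.A * E.B
  a₃ := 0
  a₄ := E.B ^ 2
  a₆ := 0

theorem weierstrass_equation_iff (E : MontgomeryCurve F) (x y : F) :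
    E.weierstrass.Equation (E.B * x) (E.B ^ 2 * y) ↔
      E.B * y ^ 2 = x * (x ^ 2 + E.A * x + 1) := by
  have hB := E.B_ne_zero
  have h3 : E.B ^ 3 ≠ 0 := pow_ne_zero 3 hB
  rw [WeierstrassCurve.Affine.equation_iff]
  simp only [weierstrass]
  constructor
  · intro h
    apply mul_left_cancel₀ h3
    linear_combination h
  · intro h
    linear_combination E.B ^ 3 * h

theorem weierstrass_isUnit_disc (E : MontgomeryCurve F) : IsUnit E.weierstrass.Δ := by
  have hB := E.B_ne_zero
  have h2 := E.two_ne_zero'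
  have h4 : E.A ^ 2 - 4 ≠ 0 := sub_ne_zero.mpr E.A_sq_ne_four
  have e : E.weierstrass.Δ = 2 ^ 4 * E.B ^ 6 * (E.A ^ 2 - 4) := by
    simp only [WeierstrassCurve.Δ, WeierstrassCurve.b₂, WeierstrassCurve.b₄,
      WeierstrassCurve.b₆, WeierstrassCurve.b₈, weierstrass]
    ring
  rw [e, isUnit_iff_ne_zero]
  exact mul_ne_zero (mul_ne_zero (pow_ne_zero _ h2) (pow_ne_zero _ hB)) h4

theorem weierstrass_nonsingular (E : MontgomeryCurve F) {u v : F}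
    (h : E.weierstrass.Equation u v) : E.weierstrass.Nonsingular u v :=
  (WeierstrassCurve.Affine.equation_iff_nonsingular_of_Δ_ne_zero
    E.weierstrass_isUnit_disc.ne_zero).mp h

/-- The bijection `(x, y) ↦ (B x, B² y)`, infinity to infinity. -/
def pointEquiv (E : MontgomeryCurve F) : E.Point ≃ E.weierstrass.Point where
  toFun
    | .infinity => .zero
    | .affine x y h =>
        .some (E.B * x) (E.B ^ 2 * y)
          (E.weierstrass_nonsingular ((E.weierstrass_equation_iff x y).mpr h))
  invFun
    | .zero => .infinity
    | .some u v h =>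
        .affine (u / E.B) (v / E.B ^ 2) (by
          have hB := E.B_ne_zero
          rw [← E.weierstrass_equation_iff, mul_div_cancel₀ _ hB,
            mul_div_cancel₀ _ (pow_ne_zero 2 hB)]
          exact h.1)
  left_inv P := by
    have hB := E.B_ne_zero
    cases P with
    | infinity => rfl
    | affine x y h => simp [hB]
  right_inv P := by
    have hB := E.B_ne_zero
    cases P with
    | zero => rfl
    | some u v h => simp [mul_div_cancel₀ _ hB, mul_div_cancel₀ _ (pow_ne_zero 2 hB)]

/-- The chord-and-tangent group law (with infinity as zero). It is preserved by linear changes of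
coordinates, so it is Mathlib's group law on the Weierstrass model. -/
noncomputable instance (E : MontgomeryCurve F) [DecidableEq F] : AddCommGroup E.Point :=
  E.pointEquiv.addCommGroup

/-- The normalized (affine) coordinates of a point; `none` is the point at infinity. -/
def Point.coords {E : MontgomeryCurve F} : E.Point → Option (F × F)
  | .infinity => none
  | .affine x y _ => some (x, y)

end MontgomeryCurve

/-! ### Counting field operations -/

/-- A vector of operation counts: multiplications `M`, squarings `S`, multiplications `mA` by one
of the constants `A` and `(A + 2) / 4`, multiplications `mB` by the constant `B`,
additions and subtractions `a`, inversions `I`. -/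
@[ext]
structure OpCount where
  M : ℕ := 0
  S : ℕ := 0
  mA : ℕ := 0
  mB : ℕ := 0
  a : ℕ := 0
  I : ℕ := 0

namespace OpCount

instance : Zero OpCount := ⟨{}⟩

instance : Add OpCount :=
  ⟨fun c d => ⟨c.M + d.M, c.S + d.S, c.mA + d.mA, c.mB + d.mB, c.a + d.a, c.I + d.I⟩⟩

/-- Componentwise comparison. -/
instance : LE OpCount :=
  ⟨fun c d => c.M ≤ d.M ∧ c.S ≤ d.S ∧ c.mA ≤ d.mA ∧ c.mB ≤ d.mB ∧ c.a ≤ d.a ∧ c.I ≤ d.I⟩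

end OpCount

/-- The result of a computation together with the field operations it has performed. -/
structure Counted (α : Type*) where
  val : α
  cost : OpCount

namespace Counted

instance : Monad Counted where
  pure a := ⟨a, 0⟩
  bind c f := ⟨(f c.val).val, c.cost + (f c.val).cost⟩

/-- `downTo k f s` runs `f (k-1)`, `f (k-2)`, …, `f 0` on the state `s`. -/
def downTo {σ : Type*} : ℕ → (ℕ → σ → Counted σ) → σ → Counted σ
  | 0, _, s => pure s
  | k + 1, f, s => do
      let s' ← f k s
      downTo k f s'

end Counted

/-! ### The routines

All field arithmetic below goes through the six counted operations. Copies, tests for equality and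
operations on the bits of the scalars are not counted. -/

namespace MontgomeryCurve

variable {F : Type*} [Field F]

/-- One multiplication. -/
def mul (x y : F) : Counted F := ⟨x * y, { M := 1 }⟩
/-- One squaring. -/
def sqr (x : F) : Counted F := ⟨x ^ 2, { S := 1 }⟩
/-- One addition. -/
def add (x y : F) : Counted F := ⟨x + y, { a := 1 }⟩
/-- One subtraction. -/
def sub (x y : F) : Counted F := ⟨x - y, { a := 1 }⟩
/-- One inversion. -/
def inv (x : F) : Counted F := ⟨x⁻¹, { I := 1 }⟩

/-- The curve constant `(A + 2) / 4`. -/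
def a24 (E : MontgomeryCurve F) : F := (E.A + 2) / 4

/-- One multiplication by the constant `A`. -/
def mulA (E : MontgomeryCurve F) (x : F) : Counted F := ⟨E.A * x, { mA := 1 }⟩
/-- One multiplication by the constant `(A + 2) / 4`. -/
def mulA24 (E : MontgomeryCurve F) (x : F) : Counted F := ⟨E.a24 * x, { mA := 1 }⟩
/-- One multiplication by the constant `B`. -/
def mulB (E : MontgomeryCurve F) (x : F) : Counted F := ⟨E.B * x, { mB := 1 }⟩

/-- `Project`, with normalized value: drop `y`. The value `none` is the image of infinity. -/
def project (P : Option (F × F)) : Option F := P.map Prod.fst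

/-- From normalized to projective coordinates `(X : Z)` on the `x`-line; infinity is `(1 : 0)`. -/
def lift : Option F → F × F
  | none => (1, 0)
  | some x => (x, 1)

/-- Pseudo-doubling. -/
def xDBL (E : MontgomeryCurve F) (p : F × F) : Counted (F × F) := do
  let s ← add p.1 p.2
  let d ← sub p.1 p.2
  let ss ← sqr s
  let dd ← sqr d
  let c ← sub ss dd
  let X ← mul ss dd
  let t ← E.mulA24 c
  let u ← add dd t
  let Z ← mul c u
  return (X, Z)

/-- Pseudo-doubling, with the constant `(A + 2) / 4` treated as a general operand. -/
def xDBLgen (E : MontgomeryCurve F) (p : F × F) : Counted (F × F) := do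
  let s ← add p.1 p.2
  let d ← sub p.1 p.2
  let ss ← sqr s
  let dd ← sqr d
  let c ← sub ss dd
  let X ← mul ss dd
  let t ← mul E.a24 c
  let u ← add dd t
  let Z ← mul c u
  return (X, Z)

/-- Differential addition `(x(P), x(Q), x(P ⊖ Q)) ↦ x(P ⊕ Q)` with normalized difference.
Two differences are treated apart: if `P ⊖ Q` is infinity then `P ⊕ Q = [2]P`, and if
`P ⊖ Q = T = (0, 0)` then `P ⊕ Q = [2]P ⊕ T`, and translation by `T` is `x ↦ 1 / x`. -/
def xADD (E : MontgomeryCurve F) [DecidableEq F] (p q : F × F) :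
    Option F → Counted (F × F)
  | none => E.xDBLgen p
  | some x =>
    if x = 0 then do
      let r ← E.xDBLgen p
      return (r.2, r.1)
    else do
      let sp ← add p.1 p.2
      let dp ← sub p.1 p.2
      let sq ← add q.1 q.2
      let dq ← sub q.1 q.2
      let u ← mul dp sq
      let v ← mul sp dq
      let w ← add u v
      let t ← sub u v
      let X ← sqr w
      let tt ← sqr t
      let Z ← mul x tt
      return (X, Z)

/-- Simultaneous doubling and differential addition
`(x(P), x(Q), x(Q ⊖ P)) ↦ (x([2]P), x(P ⊕ Q))` with normalized difference. -/
def xDBLADD (E : MontgomeryCurve F) [DecidableEq F] (p q : F × F) :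
    Option F → Counted ((F × F) × (F × F))
  | none => do
    let r ← E.xDBL p
    return (r, r)
  | some x =>
    if x = 0 then do
      let r ← E.xDBL p
      return (r, (r.2, r.1))
    else do
      let sp ← add p.1 p.2
      let dp ← sub p.1 p.2
      let sq ← add q.1 q.2
      let dq ← sub q.1 q.2
      let ss ← sqr sp
      let dd ← sqr dp
      let c ← sub ss dd
      let X2 ← mul ss dd
      let k ← E.mulA24 c
      let l ← add dd k
      let Z2 ← mul c l
      let u ← mul dp sq
      let v ← mul sp dq
      let w ← add u v
      let t ← sub u v
      let X ← sqr w
      let tt ← sqr t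
      let Z ← mul x tt
      return ((X2, Z2), (X, Z))

/-- `Recover`: from `P` (normalized), `x(Q) = (X₁ : Z₁)` and `x(Q ⊕ P) = (X₂ : Z₂)` to `Q`
(normalized), by the Okeya--Sakurai formula. If `Z₁ = 0` then `Q` is infinity; if `Z₂ = 0` then
`Q = ⊖P`. The point `P` has to be outside the 2-torsion (the value at `P = none` is a dummy). -/
def recover (E : MontgomeryCurve F) [DecidableEq F] (P : Option (F × F)) (q r : F × F) :
    Counted (Option (F × F)) :=
  match P with
  | none => pure none
  | some (x, y) =>
    if q.2 = 0 then pure none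
    else if r.2 = 0 then do
      let y' ← sub 0 y
      return some (x, y')
    else do
      let v1 ← mul x q.2
      let v2 ← add q.1 v1
      let v3 ← sub q.1 v1
      let v4 ← sqr v3
      let v5 ← mul v4 r.1
      let z2 ← add q.2 q.2
      let v6 ← E.mulA z2
      let v7 ← add v2 v6
      let v8 ← mul x q.1
      let v9 ← add v8 q.2
      let v10 ← mul v7 v9
      let v11 ← mul v6 q.2
      let v12 ← sub v10 v11
      let v13 ← mul v12 r.2
      let Y ← sub v13 v5
      let y2 ← add y y
      let w1 ← E.mulB y2
      let w2 ← mul w1 q.2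
      let w3 ← mul w2 r.2
      let X ← mul w3 q.1
      let Z ← mul w3 q.2
      let i ← inv Z
      let x' ← mul X i
      let y' ← mul Y i
      return some (x', y')

/-- `(P ⊕ Q, x(P ⊖ Q))` from normalized `P` and `Q`, both outside the 2-torsion, with one
shared inversion. Here `x(P ⊖ Q)` is obtained normalized, as its uses as a difference in `xADD` and
`xDBLADD` require; a projective differential addition of `x(P)` and `x(Q)` would not give that
without a further inversion. Products with `A` and `B` are counted as general multiplications.
(The values at infinity are dummies.) -/
def addSub (E : MontgomeryCurve F) [DecidableEq F] :
    Option (F × F) → Option (F × F) → Counted (Option (F × F) × Option F)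
  | some (x₁, y₁), some (x₂, y₂) =>
    if x₁ = x₂ then do
      -- here `Q` is `P` or `⊖P`: compute `[2]P` by the tangent
      let xx ← sqr x₁
      let t₁ ← add xx xx
      let t₂ ← add t₁ xx
      let t₃ ← mul E.A x₁
      let t₄ ← add t₃ t₃
      let t₅ ← add t₂ t₄
      let t₆ ← add t₅ 1
      let w₁ ← mul E.B y₁
      let w₂ ← add w₁ w₁
      let i ← inv w₂
      let l ← mul t₆ i
      let ll ← sqr l
      let b ← mul E.B ll
      let s₁ ← add E.A x₁
      let s₂ ← add s₁ x₁
      let x₃ ← sub b s₂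
      let e ← sub x₁ x₃
      let f ← mul l e
      let y₃ ← sub f y₁
      if y₁ = y₂ then return (some (x₃, y₃), none)
      else return (none, some x₃)
    else do
      let dx ← sub x₂ x₁
      let dy ← sub y₂ y₁
      let sy ← add y₂ y₁
      let i ← inv dx
      let l ← mul dy i
      let k ← mul sy i
      let ll ← sqr l
      let kk ← sqr k
      let b ← mul E.B ll
      let c ← mul E.B kk
      let s₁ ← add E.A x₁
      let s₂ ← add s₁ x₂
      let x₃ ← sub b s₂
      let x₄ ← sub c s₂
      let e ← sub x₁ x₃
      let f ← mul l e
      let y₃ ← sub f y₁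
      return (some (x₃, y₃), some x₄)
  | _, _ => pure (none, none)

/-! ### One-dimensional scalar multiplication -/

/-- The uniform one-dimensional scalar multiplication (project, Montgomery ladder, recover), for
`P` in normalized coordinates. The `i`-th bit of `m` is `m.testBit i`, and `m.size` is the
bitlength. -/
def uniform1 (E : MontgomeryCurve F) [DecidableEq F] (m : ℕ) (P : Option (F × F)) :
    Counted (Option (F × F)) := do
  let xP := project P
  let t₂ ← E.xDBL (lift xP)
  let t ← Counted.downTo (m.size - 1)
    (fun i (t : (F × F) × (F × F)) =>
      if m.testBit i then do
        let r ← E.xDBLADD t.2 t.1 xP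
        return (r.2, r.1)
      else
        E.xDBLADD t.1 t.2 xP)
    (lift xP, t₂)
  E.recover P t.1 t.2

/-! ### Two-dimensional scalar multiplication -/

/-- The bits `d_i` of the encoding of Bernstein's chain `C_{m₀}(m, n)`. -/
def chainBit (m n : ℕ) : ℕ → Bool
  | 0 => m.testBit 0
  | i + 1 =>
      ((!(chainBit m n i)) && (m.testBit i ^^ m.testBit (i + 1))) ^^
        (chainBit m n i && !(n.testBit i ^^ n.testBit (i + 1)))

/-- The triple `(O, E, M)` (odd-odd, even-even, mixed). -/
structure Triple (F : Type*) where
  odd : F × F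
  even : F × F
  mixed : F × F

/-- The first segment of the chain, from the top bits of `m` and `n` and the last `d_i`. The top
bits are never both zero; the value there is a dummy. -/
def chainInit (E : MontgomeryCurve F) [DecidableEq F] (xP xQ xs xd : Option F) :
    Bool → Bool → Bool → Counted (Triple F)
  | false, true, false => do
      let r ← E.xDBLADD (lift xQ) (lift xP) xd
      return { mixed := lift xQ, even := r.1, odd := r.2 }
  | false, true, true => do
      let r ← E.xDBLADD (lift xQ) (lift xs) xP
      return { odd := lift xs, even := r.1, mixed := r.2 }
  | true, false, false => do
      let r ← E.xDBLADD (lift xP) (lift xs) xQ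
      return { odd := lift xs, even := r.1, mixed := r.2 }
  | true, false, true => do
      let r ← E.xDBLADD (lift xP) (lift xQ) xd
      return { mixed := lift xP, even := r.1, odd := r.2 }
  | true, true, false => do
      let r ← E.xDBLADD (lift xs) (lift xP) xQ
      return { odd := lift xs, even := r.1, mixed := r.2 }
  | true, true, true => do
      let r ← E.xDBLADD (lift xs) (lift xQ) xP
      return { odd := lift xs, even := r.1, mixed := r.2 }
  | false, false, _ => pure ⟨(1, 0), (1, 0), (1, 0)⟩

/-- One step along the chain, for the transition vector `(c₁, c₂, c₃, c₄)`: a differential addition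
of `O` and `E`, whose difference is chosen by `c₁`, and a simultaneous doubling and differential
addition, whose operands are chosen by `(c₂, c₃, c₄)` and whose difference is chosen by `c₄`. -/
def chainStep (E : MontgomeryCurve F) [DecidableEq F] (xP xQ xs xd : Option F)
    (c₁ c₂ c₃ c₄ : Bool) (T : Triple F) : Counted (Triple F) := do
  let o ← E.xADD T.odd T.even (if c₁ then xd else xs)
  let args : (F × F) × (F × F) :=
    match c₂, c₃, c₄ with
    | false, false, _ => (T.even, T.mixed)
    | false, true, false => (T.mixed, T.even)
    | false, true, true => (T.mixed, T.odd)
    | true, false, false => (T.mixed, T.odd)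
    | true, false, true => (T.mixed, T.even)
    | true, true, _ => (T.odd, T.mixed)
  let r ← E.xDBLADD args.1 args.2 (if c₄ then xP else xQ)
  return { odd := o, even := r.1, mixed := r.2 }

/-- The uniform two-dimensional scalar multiplication based on Bernstein's binary differential
addition chain, for `P` and `Q` in normalized coordinates. -/
def uniform2 (E : MontgomeryCurve F) [DecidableEq F] (m n : ℕ) (P Q : Option (F × F)) :
    Counted (Option (F × F)) := do
  let b := (max m n).size
  let SD ← E.addSub P Q
  let S := SD.1
  let xP := project P
  let xQ := project Q
  let xs := project S
  let xd := SD.2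
  let T₀ ← E.chainInit xP xQ xs xd
    (m.testBit (b - 1)) (n.testBit (b - 1)) (chainBit m n (b - 1))
  let T ← Counted.downTo (b - 1)
    (fun i T => E.chainStep xP xQ xs xd
      (m.testBit (i + 1) ^^ n.testBit (i + 1))
      (m.testBit i ^^ m.testBit (i + 1))
      (n.testBit i ^^ n.testBit (i + 1))
      (chainBit m n i) T)
    T₀
  match m.testBit 0, n.testBit 0 with
  | false, false => E.recover S T.even T.odd
  | false, true => E.recover P T.mixed T.odd
  | true, false => E.recover P T.mixed T.even
  | true, true => E.recover S T.odd T.even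

end MontgomeryCurve

/-!
The argument has a geometric half and a combinatorial half.

Geometry. The `x`-coordinate of a point is recorded by `Represents`: a nonzero projective vector
over a value in the `x`-line. In these terms doubling and differential addition are correct on *all*
rational points, with no genericity assumption. For differential addition (`xADD_correct`) the
generic case is Montgomery's identity `x(P ⊕ Q) x(P ⊖ Q) (x(P) - x(Q))² = (x(P) x(Q) - 1)²`, which follows from the
chord formulas for `P ⊕ Q` and `P ⊖ Q`. The formulas can only degenerate to `(0 : 0)` when
`x(P) = x(Q) = ±1`; then one of `P ⊕ Q`, `P ⊖ Q` is infinity and the other is the double of a point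
with `x = ±1`, that is `(0, 0)`, so that `x(P ⊖ Q)` is `0` or infinity, and these two differences are
treated apart: if `P = Q` the sum is a double, and if `P ⊖ Q = (0, 0)` it is a double translated
by `(0, 0)`, where translation by `(0, 0)` is `x ↦ 1 / x` (`Represents.swap_of_add`).
`recover_correct` is the Okeya–Sakurai formula, again with the chord formula behind it.

Combinatorics. Both algorithms are loops with an invariant. The ladder holds `x([k]P)` and
`x([k + 1]P)` for `k = ⌊m / 2 ^ i⌋`. The two-dimensional chain holds three of the four
`x([a + i]P ⊕ [b + j]Q)`, `i, j ∈ {0, 1}`, for `a = ⌊m / 2 ^ i⌋` and `b = ⌊n / 2 ^ i⌋`, sorted by the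
parities of the coefficients (`ChainInvariant`). One step needs two of them whose sum is the
required mixed element, and the recursion for the bits `d_i` says that the mixed component which is
needed is the one which is stored (`ChainInvariant.chainStep`).

The operation counts are sums of the counts of the subroutines, which are bounded uniformly over
all branches.
-/

namespace MontgomeryCurve

variable {F : Type*} [Field F] (E : MontgomeryCurve F)

/-! ### The group law in Montgomery coordinates -/

namespace Point

variable {E}

theorem coords_injective : Function.Injective (coords (E := E)) := by
  rintro (_ | ⟨x, y, h⟩) (_ | ⟨x', y', h'⟩) e <;> simp_all [coords]

/-- Group-law computations on the Weierstrass model are read back in Montgomery coordinates. -/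
theorem coords_of_pointEquiv_eq {R : E.Point} {u v : F} {h : E.weierstrass.Nonsingular u v}
    (e : E.pointEquiv R = .some u v h) : R.coords = some (u / E.B, v / E.B ^ 2) := by
  rw [← E.pointEquiv.symm_apply_apply R, e]
  rfl

theorem eq_or_eq_neg_of_fst_eq {x y y' : F} (h : E.B * y ^ 2 = x * (x ^ 2 + E.A * x + 1))
    (h' : E.B * y' ^ 2 = x * (x ^ 2 + E.A * x + 1)) : y = y' ∨ y = -y' :=
  sq_eq_sq_iff_eq_or_eq_neg.mp (mul_left_cancel₀ E.B_ne_zero (h.trans h'.symm))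

variable [DecidableEq F]

theorem pointEquiv_add (P Q : E.Point) :
    E.pointEquiv (P + Q) = E.pointEquiv P + E.pointEquiv Q :=
  E.pointEquiv.apply_symm_apply _

theorem pointEquiv_neg (P : E.Point) : E.pointEquiv (-P) = -E.pointEquiv P :=
  E.pointEquiv.apply_symm_apply _

@[simp]
theorem coords_zero : (0 : E.Point).coords = none := rfl

theorem coords_eq_none_iff {P : E.Point} : P.coords = none ↔ P = 0 :=
  ⟨fun h => coords_injective (h.trans coords_zero.symm), fun h => by rw [h, coords_zero]⟩

theorem neg_affine (x y : F) (h : E.B * y ^ 2 = x * (x ^ 2 + E.A * x + 1)) :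
    -(affine x y h : E.Point) = affine x (-y) (by rw [neg_sq, h]) := by
  have hB := E.B_ne_zero
  apply coords_injective
  have e := (pointEquiv_neg (affine x y h : E.Point)).trans
    (WeierstrassCurve.Affine.Point.neg_some _)
  rw [coords_of_pointEquiv_eq e]
  simp only [coords, WeierstrassCurve.Affine.negY, weierstrass]
  rw [Option.some_inj, Prod.mk.injEq, div_eq_iff hB, div_eq_iff (pow_ne_zero 2 hB)]
  constructor <;> ring

/-- The chord formulas. -/
theorem coords_add_of_ne {x₁ y₁ x₂ y₂ : F} {h₁ : E.B * y₁ ^ 2 = x₁ * (x₁ ^ 2 + E.A * x₁ + 1)}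
    {h₂ : E.B * y₂ ^ 2 = x₂ * (x₂ ^ 2 + E.A * x₂ + 1)} (hx : x₁ ≠ x₂) {l x : F}
    (hl : l = (y₂ - y₁) / (x₂ - x₁)) (hx' : x = E.B * l ^ 2 - (E.A + x₁ + x₂)) :
    (affine x₁ y₁ h₁ + affine x₂ y₂ h₂ : E.Point).coords = some (x, l * (x₁ - x) - y₁) := by
  have hB := E.B_ne_zero
  have hd : x₂ - x₁ ≠ 0 := sub_ne_zero.mpr hx.symm
  have hd' : x₁ - x₂ ≠ 0 := sub_ne_zero.mpr hx
  have hu : E.B * x₁ ≠ E.B * x₂ := fun e => hx (mul_left_cancel₀ hB e)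
  have hs : (E.B ^ 2 * y₁ - E.B ^ 2 * y₂) / (E.B * x₁ - E.B * x₂) = E.B * l := by
    rw [hl, ← mul_sub, ← mul_sub, ← neg_sub y₂ y₁, ← neg_sub x₂ x₁]
    field_simp
  have e := (pointEquiv_add (affine x₁ y₁ h₁ : E.Point) (affine x₂ y₂ h₂)).trans
    (WeierstrassCurve.Affine.Point.add_of_X_ne hu)
  rw [coords_of_pointEquiv_eq e]
  simp only [WeierstrassCurve.Affine.slope_of_X_ne hu, hs, WeierstrassCurve.Affine.addX,
    WeierstrassCurve.Affine.addY, WeierstrassCurve.Affine.negAddY,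
    WeierstrassCurve.Affine.negY, weierstrass]
  rw [Option.some_inj, Prod.mk.injEq, div_eq_iff hB, div_eq_iff (pow_ne_zero 2 hB), hx']
  constructor <;> ring

/-- The tangent formulas. -/
theorem coords_double {x₁ y₁ : F} {h₁ : E.B * y₁ ^ 2 = x₁ * (x₁ ^ 2 + E.A * x₁ + 1)}
    (hy : y₁ ≠ 0) {l x : F}
    (hl : l = (3 * x₁ ^ 2 + 2 * E.A * x₁ + 1) / (2 * E.B * y₁))
    (hx' : x = E.B * l ^ 2 - (E.A + x₁ + x₁)) :
    (affine x₁ y₁ h₁ + affine x₁ y₁ h₁ : E.Point).coords = some (x, l * (x₁ - x) - y₁) := by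
  have hB := E.B_ne_zero
  have h2 := E.two_ne_zero'
  have hn : E.weierstrass.negY (E.B * x₁) (E.B ^ 2 * y₁) = -(E.B ^ 2 * y₁) := by
    simp [WeierstrassCurve.Affine.negY, weierstrass]
  have hd : E.B ^ 2 * y₁ - -(E.B ^ 2 * y₁) ≠ 0 := by
    rw [sub_neg_eq_add, ← two_mul]
    exact mul_ne_zero h2 (mul_ne_zero (pow_ne_zero 2 hB) hy)
  have hu : E.B ^ 2 * y₁ ≠ E.weierstrass.negY (E.B * x₁) (E.B ^ 2 * y₁) := by
    rw [hn]
    exact sub_ne_zero.mp hd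
  have hs : E.weierstrass.slope (E.B * x₁) (E.B * x₁) (E.B ^ 2 * y₁) (E.B ^ 2 * y₁) =
      E.B * l := by
    rw [WeierstrassCurve.Affine.slope_of_Y_ne rfl hu, hn, hl, div_eq_iff hd]
    simp only [weierstrass]
    field_simp
    ring
  have e := (pointEquiv_add (affine x₁ y₁ h₁ : E.Point) (affine x₁ y₁ h₁)).trans
    (WeierstrassCurve.Affine.Point.add_self_of_Y_ne hu)
  rw [coords_of_pointEquiv_eq e, hs]
  simp only [WeierstrassCurve.Affine.addX,
    WeierstrassCurve.Affine.addY, WeierstrassCurve.Affine.negAddY,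
    WeierstrassCurve.Affine.negY, weierstrass]
  rw [Option.some_inj, Prod.mk.injEq, div_eq_iff hB, div_eq_iff (pow_ne_zero 2 hB), hx']
  constructor <;> ring

theorem two_nsmul_affine_eq_zero_iff {x y : F} {h : E.B * y ^ 2 = x * (x ^ 2 + E.A * x + 1)} :
    2 • (affine x y h : E.Point) = 0 ↔ y = 0 := by
  rw [two_nsmul, ← eq_neg_iff_add_eq_zero, neg_affine]
  simp only [affine.injEq, true_and]
  rw [eq_neg_iff_add_eq_zero, ← two_mul, mul_eq_zero, or_iff_right E.two_ne_zero']

end Point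

end MontgomeryCurve

namespace MontgomeryCurve

variable {F : Type*} [Field F] (E : MontgomeryCurve F)

/-! ### The `x`-line -/

/-- The image of a point on the `x`-line, normalized: `none` is the image of infinity. -/
def Point.x {E : MontgomeryCurve F} (P : E.Point) : Option F := project P.coords

/-- The pair `p = (X, Z)` is a vector of projective coordinates of the normalized value `o`.
Both coordinates vanishing is excluded. -/
def Represents (p : F × F) : Option F → Prop
  | none => p.1 ≠ 0 ∧ p.2 = 0
  | some x => p.2 ≠ 0 ∧ p.1 = x * p.2

theorem represents_lift (o : Option F) : Represents (lift o) o := by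
  cases o <;> simp [Represents, lift]

theorem four_ne_zero' (E : MontgomeryCurve F) : (4 : F) ≠ 0 := by
  rw [show (4 : F) = 2 * 2 by norm_num]
  exact mul_ne_zero E.two_ne_zero' E.two_ne_zero'

theorem a24_mul_four : E.a24 * 4 = E.A + 2 := by
  rw [a24, div_mul_cancel₀ _ E.four_ne_zero']

theorem cubic_factor_ne_zero_of_sq_eq_one {x : F} (hx : x ^ 2 = 1) :
    x ^ 2 + E.A * x + 1 ≠ 0 := by
  intro h
  apply E.A_sq_ne_four
  linear_combination (E.A * x - 2) * h - (E.A * x + E.A ^ 2 - 2) * hx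

theorem four_B_ne_zero : 4 * E.B ≠ 0 := by
  exact mul_ne_zero E.four_ne_zero' E.B_ne_zero

theorem xDBL_val (E : MontgomeryCurve F) (p : F × F) :
    (E.xDBL p).val = ((p.1 ^ 2 - p.2 ^ 2) ^ 2,
      4 * (p.1 * p.2 * (p.1 ^ 2 + E.A * (p.1 * p.2) + p.2 ^ 2))) := by
  have h := E.a24_mul_four
  have e : (E.xDBL p).val = ((p.1 + p.2) ^ 2 * (p.1 - p.2) ^ 2,
      ((p.1 + p.2) ^ 2 - (p.1 - p.2) ^ 2) *
        ((p.1 - p.2) ^ 2 + E.a24 * ((p.1 + p.2) ^ 2 - (p.1 - p.2) ^ 2))) := rfl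
  rw [e, Prod.mk.injEq]
  constructor
  · ring
  · linear_combination 4 * (p.1 * p.2) ^ 2 * h

/-- Montgomery's differential addition identity
`x(P ⊕ Q) x(P ⊖ Q) (x(P) - x(Q))² = (x(P) x(Q) - 1)²`. -/
theorem differential_addition {E : MontgomeryCurve F}
    {x₁ y₁ x₂ y₂ x₃ x₄ : F}
    (h₁ : E.B * y₁ ^ 2 = x₁ * (x₁ ^ 2 + E.A * x₁ + 1))
    (h₂ : E.B * y₂ ^ 2 = x₂ * (x₂ ^ 2 + E.A * x₂ + 1)) (hx : x₁ ≠ x₂)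
    (h₃ : x₃ = E.B * ((y₂ - y₁) / (x₂ - x₁)) ^ 2 - (E.A + x₁ + x₂))
    (h₄ : x₄ = E.B * ((-y₂ - y₁) / (x₂ - x₁)) ^ 2 - (E.A + x₁ + x₂)) :
    x₃ * x₄ * (x₁ - x₂) ^ 2 = (x₁ * x₂ - 1) ^ 2 := by
  have hd : x₂ - x₁ ≠ 0 := sub_ne_zero.mpr hx.symm
  have e₃ : x₃ * (x₂ - x₁) ^ 2 =
      (x₁ + x₂) * (x₁ * x₂ + 1) + 2 * E.A * x₁ * x₂ - 2 * E.B * y₁ * y₂ := by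
    rw [h₃]
    field_simp
    linear_combination h₁ + h₂
  have e₄ : x₄ * (x₂ - x₁) ^ 2 =
      (x₁ + x₂) * (x₁ * x₂ + 1) + 2 * E.A * x₁ * x₂ + 2 * E.B * y₁ * y₂ := by
    rw [h₄]
    field_simp
    linear_combination h₁ + h₂
  apply mul_right_cancel₀ (pow_ne_zero 2 hd)
  have e : x₃ * x₄ * (x₁ - x₂) ^ 2 * (x₂ - x₁) ^ 2 =
      (x₃ * (x₂ - x₁) ^ 2) * (x₄ * (x₂ - x₁) ^ 2) := by ring
  rw [e, e₃, e₄]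
  linear_combination (-4 * E.B * y₂ ^ 2) * h₁ -
    4 * (x₁ * (x₁ ^ 2 + E.A * x₁ + 1)) * h₂

namespace Point

variable {E}

theorem snd_eq_zero_of_fst_eq_zero {y : F} (h : E.B * y ^ 2 = 0 * (0 ^ 2 + E.A * 0 + 1)) :
    y = 0 := by
  rw [zero_mul] at h
  exact (pow_eq_zero_iff two_ne_zero).mp ((mul_eq_zero.mp h).resolve_left E.B_ne_zero)

theorem x_of_coords {P : E.Point} {x y : F} (h : P.coords = some (x, y)) : P.x = some x := by
  rw [Point.x, h]
  rfl

@[simp]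
theorem x_affine (x y : F) (h : E.B * y ^ 2 = x * (x ^ 2 + E.A * x + 1)) :
    (affine x y h : E.Point).x = some x := rfl

variable [DecidableEq F]

@[simp]
theorem x_zero : (0 : E.Point).x = none := rfl

@[simp]
theorem infinity_eq_zero : (infinity : E.Point) = 0 := rfl

theorem x_eq_none_iff {P : E.Point} : P.x = none ↔ P = 0 := by
  rw [← coords_eq_none_iff, Point.x, project, Option.map_eq_none_iff]

@[simp]
theorem x_neg (P : E.Point) : (-P).x = P.x := by
  cases P with
  | infinity => rw [infinity_eq_zero, neg_zero]
  | affine x y h => rw [neg_affine]; rfl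

theorem x_sub_comm (P Q : E.Point) : (P - Q).x = (Q - P).x := by
  rw [← neg_sub, x_neg]

/-- The points with `x = 0` have order two. -/
theorem neg_eq_of_x_eq_zero {T : E.Point} (h : T.x = some 0) : -T = T := by
  cases T with
  | infinity => exact absurd h nofun
  | affine x y hxy =>
    obtain rfl : x = 0 := Option.some_inj.mp h
    obtain rfl := snd_eq_zero_of_fst_eq_zero hxy
    rw [neg_affine]
    simp only [neg_zero]

end Point

variable [DecidableEq F]

variable {E}

open Point

/-- Translation by the point `(0, 0)` is `x ↦ 1 / x`. -/
theorem Represents.swap_of_add {p : F × F} {R T : E.Point} (hT : T.x = some 0)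
    (h : Represents p R.x) : Represents (p.2, p.1) (R + T).x := by
  have hnT := neg_eq_of_x_eq_zero hT
  cases R with
  | infinity =>
    rw [infinity_eq_zero, zero_add, hT]
    exact ⟨h.1, by rw [zero_mul]; exact h.2⟩
  | affine x y hxy =>
    rcases eq_or_ne x 0 with rfl | hx
    · obtain rfl : affine 0 y hxy = T := by
        cases T with
        | infinity => exact absurd hT nofun
        | affine x' y' h' =>
          obtain rfl : x' = 0 := Option.some_inj.mp hT
          obtain rfl := snd_eq_zero_of_fst_eq_zero hxy
          obtain rfl := snd_eq_zero_of_fst_eq_zero h'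
          rfl
      rw [eq_neg_iff_add_eq_zero.mp hnT.symm, x_zero]
      exact ⟨h.1, by simpa using h.2⟩
    · cases T with
      | infinity => exact absurd hT nofun
      | affine x' y' h' =>
        obtain rfl : x' = 0 := Option.some_inj.mp hT
        obtain rfl := snd_eq_zero_of_fst_eq_zero h'
        rw [x_of_coords (coords_add_of_ne hx rfl rfl)]
        refine ⟨?_, ?_⟩
        · show p.1 ≠ 0
          rw [h.2]
          exact mul_ne_zero hx h.1
        · show p.2 = _ * p.1
          rw [h.2]
          have e : E.B * ((0 - y) / (0 - x)) ^ 2 - (E.A + x + 0) = 1 / x := by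
            field_simp
            linear_combination x * hxy
          rw [e, ← mul_assoc, one_div_mul_cancel hx, one_mul]

/-- The `x`-coordinate of a double, in the form `x([2]P) · 4 B y² = (x² - 1)²`. -/
theorem x_double {x y : F} {h : E.B * y ^ 2 = x * (x ^ 2 + E.A * x + 1)} (hy : y ≠ 0) :
    ∃ x' y', (affine x y h + affine x y h : E.Point).coords = some (x', y') ∧
      x' * (4 * (x * (x ^ 2 + E.A * x + 1))) = (x ^ 2 - 1) ^ 2 := by
  refine ⟨_, _, coords_double hy rfl rfl, ?_⟩
  have hB := E.B_ne_zero
  have h2 := E.two_ne_zero'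
  rw [← h]
  field_simp
  linear_combination (-16 * (E.A + 2 * x)) * h

theorem xDBL_correct {p : F × F} {R : E.Point} (h : Represents p R.x) :
    Represents (E.xDBL p).val (R + R).x := by
  rw [xDBL_val]
  cases R with
  | infinity =>
    obtain ⟨h1, h2⟩ : p.1 ≠ 0 ∧ p.2 = 0 := h
    rw [infinity_eq_zero, zero_add, x_zero]
    refine ⟨?_, ?_⟩ <;> simp [h1, h2]
  | affine x y hxy =>
    obtain ⟨h1, h2⟩ : p.2 ≠ 0 ∧ p.1 = x * p.2 := h
    have e2 : 4 * (p.1 * p.2 * (p.1 ^ 2 + E.A * (p.1 * p.2) + p.2 ^ 2)) =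
        4 * (x * (x ^ 2 + E.A * x + 1)) * p.2 ^ 4 := by rw [h2]; ring
    have e1 : (p.1 ^ 2 - p.2 ^ 2) ^ 2 = (x ^ 2 - 1) ^ 2 * p.2 ^ 4 := by rw [h2]; ring
    rw [e1, e2]
    have h4 : p.2 ^ 4 ≠ 0 := pow_ne_zero 4 h1
    by_cases hy : y = 0
    · rw [← two_nsmul, two_nsmul_affine_eq_zero_iff.mpr hy, x_zero]
      have h0 : x * (x ^ 2 + E.A * x + 1) = 0 := by rw [← hxy, hy]; ring
      refine ⟨mul_ne_zero (pow_ne_zero 2 fun hx => ?_) h4, by rw [h0]; ring⟩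
      have hx' : x ^ 2 = 1 := sub_eq_zero.mp hx
      refine mul_ne_zero ?_ (E.cubic_factor_ne_zero_of_sq_eq_one hx') h0
      rintro rfl
      simp at hx'
    · obtain ⟨x', y', hc, hx'⟩ := x_double (h := hxy) hy
      rw [x_of_coords hc]
      refine ⟨mul_ne_zero ?_ h4, ?_⟩
      · rw [← hxy, ← mul_assoc]
        exact mul_ne_zero E.four_B_ne_zero (pow_ne_zero 2 hy)
      · show (x ^ 2 - 1) ^ 2 * p.2 ^ 4 = x' * (_ * p.2 ^ 4)
        rw [← mul_assoc, hx']

theorem xADD_val_of_ne_zero (E : MontgomeryCurve F) (p q : F × F) {x : F} (hx : x ≠ 0) :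
    (E.xADD p q (some x)).val = (4 * (p.1 * q.1 - p.2 * q.2) ^ 2,
      x * (4 * (p.1 * q.2 - p.2 * q.1) ^ 2)) := by
  have e : (E.xADD p q (some x)).val =
      (((p.1 - p.2) * (q.1 + q.2) + (p.1 + p.2) * (q.1 - q.2)) ^ 2,
        x * ((p.1 - p.2) * (q.1 + q.2) - (p.1 + p.2) * (q.1 - q.2)) ^ 2) := by
    simp only [xADD, if_neg hx]
    rfl
  rw [e, Prod.mk.injEq]
  constructor <;> ring

theorem xADD_correct {p q : F × F} {P Q : E.Point} (hp : Represents p P.x)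
    (hq : Represents q Q.x) : Represents (E.xADD p q (P - Q).x).val (P + Q).x := by
  have h4 := E.four_ne_zero'
  rcases hδ : (P - Q).x with _ | δ
  · obtain rfl : P = Q := sub_eq_zero.mp (x_eq_none_iff.mp hδ)
    exact xDBL_correct hp
  rcases eq_or_ne δ 0 with rfl | hδ0
  · -- `P ⊖ Q` is its own negative.
    have e : P + Q = P + P + (P - Q) := by
      rw [← neg_eq_of_x_eq_zero hδ]
      abel
    rw [e]
    have := (xDBL_correct hp).swap_of_add hδ
    simp only [xADD, if_pos]
    exact this
  rw [xADD_val_of_ne_zero E p q hδ0]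
  have hPQ : P ≠ Q := by
    rintro rfl
    rw [sub_self] at hδ
    exact absurd hδ nofun
  cases P with
  | infinity =>
    obtain ⟨hp1, hp2⟩ : p.1 ≠ 0 ∧ p.2 = 0 := hp
    rw [infinity_eq_zero, zero_sub, x_neg] at hδ
    rw [hδ] at hq
    obtain ⟨hq2, hq1⟩ : q.2 ≠ 0 ∧ q.1 = δ * q.2 := hq
    rw [infinity_eq_zero, zero_add, hδ]
    refine ⟨?_, ?_⟩
    · simp [hp1, hp2, hq2, hδ0, h4]
    · simp only [hp2, hq1]
      ring
  | affine x₁ y₁ h₁ =>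
    obtain ⟨hp2, hp1⟩ : p.2 ≠ 0 ∧ p.1 = x₁ * p.2 := hp
    cases Q with
    | infinity =>
      obtain ⟨hq1, hq2⟩ : q.1 ≠ 0 ∧ q.2 = 0 := hq
      rw [infinity_eq_zero, sub_zero, x_affine, Option.some_inj] at hδ
      subst hδ
      rw [infinity_eq_zero, add_zero, x_affine]
      refine ⟨?_, ?_⟩
      · simp [hp2, hq1, hq2, hδ0, h4]
      · simp only [hp1, hq2]
        ring
    | affine x₂ y₂ h₂ =>
      obtain ⟨hq2, hq1⟩ : q.2 ≠ 0 ∧ q.1 = x₂ * q.2 := hq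
      have hpq : p.2 * q.2 ≠ 0 := mul_ne_zero hp2 hq2
      have eX : 4 * (p.1 * q.1 - p.2 * q.2) ^ 2 =
          4 * (p.2 * q.2) ^ 2 * (x₁ * x₂ - 1) ^ 2 := by rw [hp1, hq1]; ring
      have eZ : δ * (4 * (p.1 * q.2 - p.2 * q.1) ^ 2) =
          4 * (p.2 * q.2) ^ 2 * (δ * (x₁ - x₂) ^ 2) := by rw [hp1, hq1]; ring
      have hc : 4 * (p.2 * q.2) ^ 2 ≠ 0 := mul_ne_zero h4 (pow_ne_zero 2 hpq)
      rw [eX, eZ]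
      rcases eq_or_ne x₁ x₂ with rfl | hx
      · -- Here `Q = ⊖P`: the sum is infinity, and `x([2]P) ≠ 0` excludes `x(P) = ±1`.
        obtain rfl : y₂ = -y₁ :=
          (Point.eq_or_eq_neg_of_fst_eq h₂ h₁).resolve_left fun e => hPQ (by subst e; rfl)
        have hQ : (affine x₁ (-y₁) h₂ : E.Point) = -affine x₁ y₁ h₁ := (neg_affine _ _ _).symm
        rw [hQ, add_neg_cancel, x_zero]
        rw [hQ, sub_neg_eq_add] at hδ
        have hy : y₁ ≠ 0 := by
          intro e
          rw [← two_nsmul, two_nsmul_affine_eq_zero_iff.mpr e] at hδ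
          exact absurd hδ nofun
        obtain ⟨x', y', hco, hx'⟩ := x_double (h := h₁) hy
        rw [x_of_coords hco, Option.some_inj] at hδ
        subst hδ
        refine ⟨mul_ne_zero hc ?_, by ring⟩
        have : (x₁ * x₁ - 1) ^ 2 = x' * (4 * (x₁ * (x₁ ^ 2 + E.A * x₁ + 1))) := by
          rw [hx']; ring
        rw [this, ← h₁, ← mul_assoc 4]
        exact mul_ne_zero hδ0 (mul_ne_zero E.four_B_ne_zero (pow_ne_zero 2 hy))
      · rw [sub_eq_add_neg, neg_affine, x_of_coords (coords_add_of_ne hx rfl rfl),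
          Option.some_inj] at hδ
        rw [x_of_coords (coords_add_of_ne hx rfl rfl)]
        have key := differential_addition h₁ h₂ hx rfl hδ.symm
        refine ⟨mul_ne_zero hc (mul_ne_zero hδ0 (pow_ne_zero 2 (sub_ne_zero.mpr hx))), ?_⟩
        show 4 * (p.2 * q.2) ^ 2 * (x₁ * x₂ - 1) ^ 2 = _ * (4 * (p.2 * q.2) ^ 2 * _)
        rw [← key]
        ring

theorem xDBLADD_val (E : MontgomeryCurve F) (p q : F × F) (δ : Option F) :
    (E.xDBLADD p q δ).val = ((E.xDBL p).val, (E.xADD p q δ).val) := by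
  rcases δ with _ | δ
  · rfl
  · by_cases h : δ = 0
    · simp only [xDBLADD, xADD, if_pos h]
      rfl
    · simp only [xDBLADD, xADD, if_neg h]
      rfl

theorem xDBLADD_correct {p q : F × F} {P Q : E.Point} {δ : Option F} (hp : Represents p P.x)
    (hq : Represents q Q.x) (hδ : δ = (Q - P).x) :
    Represents (E.xDBLADD p q δ).val.1 (P + P).x ∧
      Represents (E.xDBLADD p q δ).val.2 (P + Q).x := by
  rw [xDBLADD_val, hδ, x_sub_comm]
  exact ⟨xDBL_correct hp, xADD_correct hp hq⟩

end MontgomeryCurve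

namespace MontgomeryCurve

variable {F : Type*} [Field F] {E : MontgomeryCurve F} [DecidableEq F]

open Point

/-! ### Recovery of the `y`-coordinate, and sum and difference of two points -/

theorem recover_val_affine (E : MontgomeryCurve F) (x y : F) {q r : F × F} (hq : q.2 ≠ 0)
    (hr : r.2 ≠ 0) :
    (E.recover (some (x, y)) q r).val =
      some (E.B * (y + y) * q.2 * r.2 * q.1 * (E.B * (y + y) * q.2 * r.2 * q.2)⁻¹,
        (((q.1 + x * q.2 + E.A * (q.2 + q.2)) * (x * q.1 + q.2) - E.A * (q.2 + q.2) * q.2) * r.2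
          - (q.1 - x * q.2) ^ 2 * r.1) * (E.B * (y + y) * q.2 * r.2 * q.2)⁻¹) := by
  simp only [recover, if_neg hq, if_neg hr]
  rfl

/-- The affine form of the Okeya–Sakurai formula. -/
theorem okeya_sakurai {x y x₁ y₁ x₂ y₂ : F} {h : E.B * y ^ 2 = x * (x ^ 2 + E.A * x + 1)}
    {h₁ : E.B * y₁ ^ 2 = x₁ * (x₁ ^ 2 + E.A * x₁ + 1)} (hy : y ≠ 0)
    (hs : (affine x₁ y₁ h₁ + affine x y h : E.Point).coords = some (x₂, y₂)) :
    (x₁ + x + 2 * E.A) * (x * x₁ + 1) - 2 * E.A - (x₁ - x) ^ 2 * x₂ = 2 * E.B * y * y₁ := by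
  rcases eq_or_ne x₁ x with rfl | hx
  · rcases Point.eq_or_eq_neg_of_fst_eq h h₁ with rfl | rfl
    · linear_combination -2 * h
    · have : (affine x₁ (-y₁) h : E.Point) = -affine x₁ y₁ h₁ := (neg_affine _ _ _).symm
      rw [this, add_neg_cancel, coords_zero] at hs
      exact absurd hs nofun
  · rw [coords_add_of_ne hx rfl rfl, Option.some_inj, Prod.mk.injEq] at hs
    have hd : x - x₁ ≠ 0 := sub_ne_zero.mpr hx.symm
    have e : x₂ * (x - x₁) ^ 2 = E.B * (y - y₁) ^ 2 - (E.A + x₁ + x) * (x - x₁) ^ 2 := by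
      rw [← hs.1]
      field_simp
    linear_combination -e - h - h₁

theorem recover_correct {P R : E.Point} (hP : 2 • P ≠ 0) {q r : F × F}
    (hq : Represents q R.x) (hr : Represents r (R + P).x) :
    (E.recover P.coords q r).val = R.coords := by
  cases P with
  | infinity => rw [infinity_eq_zero, smul_zero] at hP; exact absurd rfl hP
  | affine x y h =>
    have hy : y ≠ 0 := fun e => hP (two_nsmul_affine_eq_zero_iff.mpr e)
    cases R with
    | infinity =>
      have hq2 : q.2 = 0 := hq.2
      simp only [coords, recover, if_pos hq2]
      rfl
    | affine x₁ y₁ h₁ =>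
      obtain ⟨hq2, hq1⟩ : q.2 ≠ 0 ∧ q.1 = x₁ * q.2 := hq
      rcases hc : (affine x₁ y₁ h₁ + affine x y h : E.Point).coords with _ | ⟨x₂, y₂⟩
      · have h0 := coords_eq_none_iff.mp hc
        rw [h0] at hr
        have hr2 : r.2 = 0 := hr.2
        rw [eq_neg_of_add_eq_zero_left h0, neg_affine]
        simp only [coords, recover, if_neg hq2, if_pos hr2]
        show some (x, 0 - y) = _
        rw [zero_sub]
      · rw [x_of_coords hc] at hr
        obtain ⟨hr2, hr1⟩ : r.2 ≠ 0 ∧ r.1 = x₂ * r.2 := hr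
        have key := okeya_sakurai hy hc
        have hyy : y + y ≠ 0 := by
          rw [← two_mul]
          exact mul_ne_zero E.two_ne_zero' hy
        have hd : E.B * (y + y) * q.2 * r.2 * q.2 ≠ 0 :=
          mul_ne_zero (mul_ne_zero (mul_ne_zero (mul_ne_zero E.B_ne_zero hyy) hq2) hr2) hq2
        show (E.recover (some (x, y)) q r).val = some (x₁, y₁)
        rw [recover_val_affine E x y hq2 hr2, Option.some_inj, Prod.mk.injEq,
          ← div_eq_mul_inv, ← div_eq_mul_inv, div_eq_iff hd, div_eq_iff hd, hq1, hr1]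
        constructor
        · ring
        · linear_combination q.2 ^ 2 * r.2 * key

theorem addSub_correct {P Q : E.Point} (hP : 2 • P ≠ 0) (hQ : 2 • Q ≠ 0) :
    (E.addSub P.coords Q.coords).val = ((P + Q).coords, (P - Q).x) := by
  cases P with
  | infinity => rw [infinity_eq_zero, smul_zero] at hP; exact absurd rfl hP
  | affine x₁ y₁ h₁ =>
  cases Q with
  | infinity => rw [infinity_eq_zero, smul_zero] at hQ; exact absurd rfl hQ
  | affine x₂ y₂ h₂ =>
    have hy : y₁ ≠ 0 := fun e => hP (two_nsmul_affine_eq_zero_iff.mpr e)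
    rcases eq_or_ne x₁ x₂ with rfl | hx
    · -- Here `Q` is `P` or `⊖P`. The slope of the tangent is brought into the shape in which
      -- `addSub` evaluates it.
      have hl : (x₁ ^ 2 + x₁ ^ 2 + x₁ ^ 2 + (E.A * x₁ + E.A * x₁) + 1) *
          (E.B * y₁ + E.B * y₁)⁻¹ = (3 * x₁ ^ 2 + 2 * E.A * x₁ + 1) / (2 * E.B * y₁) := by
        rw [div_eq_mul_inv]
        congr 1
        · ring
        · congr 1
          ring
      have hco := coords_double (h₁ := h₁) hy hl rfl
      by_cases hyy : y₁ = y₂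
      · subst hyy
        rw [hco, sub_self, x_zero]
        simp only [coords, addSub, if_pos]
        rfl
      · obtain rfl : y₂ = -y₁ :=
          (Point.eq_or_eq_neg_of_fst_eq h₂ h₁).resolve_left (Ne.symm hyy)
        have hQ' : (affine x₁ (-y₁) h₂ : E.Point) = -affine x₁ y₁ h₁ := (neg_affine _ _ _).symm
        rw [hQ', add_neg_cancel, sub_neg_eq_add, x_of_coords hco, ← hQ']
        simp only [coords, addSub, if_pos, if_neg hyy]
        rfl
    · have hl : (y₂ - y₁) * (x₂ - x₁)⁻¹ = (y₂ - y₁) / (x₂ - x₁) := (div_eq_mul_inv _ _).symm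
      -- `addSub` uses the slope through `P` and `⊖Q` up to its sign, which the square removes.
      have hk : (y₂ + y₁) * (x₂ - x₁)⁻¹ = -((-y₂ - y₁) / (x₂ - x₁)) := by
        rw [div_eq_mul_inv]
        ring
      rw [sub_eq_add_neg, neg_affine, coords_add_of_ne hx hl rfl,
        x_of_coords (coords_add_of_ne hx rfl (by rw [← neg_sq, ← hk]))]
      simp only [coords, addSub, if_neg hx]
      rfl

end MontgomeryCurve

/-! ### Loops and operation counts -/

namespace OpCount

theorem le_def {c d : OpCount} : c ≤ d ↔ c.M ≤ d.M ∧ c.S ≤ d.S ∧ c.mA ≤ d.mA ∧ c.mB ≤ d.mB ∧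
    c.a ≤ d.a ∧ c.I ≤ d.I :=
  Iff.rfl

@[simp]
theorem mk_add_mk (M S mA mB a I M' S' mA' mB' a' I' : ℕ) :
    (⟨M, S, mA, mB, a, I⟩ + ⟨M', S', mA', mB', a', I'⟩ : OpCount) =
      ⟨M + M', S + S', mA + mA', mB + mB', a + a', I + I'⟩ :=
  rfl

@[simp]
theorem zero_def : (0 : OpCount) = ⟨0, 0, 0, 0, 0, 0⟩ := rfl

theorem le_refl (c : OpCount) : c ≤ c := by
  simp [le_def]

theorem zero_le (c : OpCount) : 0 ≤ c :=
  ⟨Nat.zero_le _, Nat.zero_le _, Nat.zero_le _, Nat.zero_le _, Nat.zero_le _, Nat.zero_le _⟩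

theorem add_le_add {a b c d : OpCount} (h₁ : a ≤ b) (h₂ : c ≤ d) : a + c ≤ b + d := by
  obtain ⟨_, _, _, _, _, _⟩ := h₁
  obtain ⟨_, _, _, _, _, _⟩ := h₂
  refine ⟨?_, ?_, ?_, ?_, ?_, ?_⟩ <;> apply Nat.add_le_add <;> assumption

theorem le_trans {a b c : OpCount} (h₁ : a ≤ b) (h₂ : b ≤ c) : a ≤ c := by
  obtain ⟨_, _, _, _, _, _⟩ := h₁
  obtain ⟨_, _, _, _, _, _⟩ := h₂
  refine ⟨?_, ?_, ?_, ?_, ?_, ?_⟩ <;> apply Nat.le_trans <;> assumption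

/-- The `k`-fold sum of an operation count. -/
def times (k : ℕ) (c : OpCount) : OpCount :=
  { M := k * c.M, S := k * c.S, mA := k * c.mA, mB := k * c.mB, a := k * c.a, I := k * c.I }

end OpCount

namespace Counted

universe u

theorem val_bind {α β : Type u} (x : Counted α) (f : α → Counted β) :
    (x >>= f).val = (f x.val).val :=
  rfl

@[simp]
theorem cost_pure {α : Type*} (x : α) : (pure x : Counted α).cost = 0 := rfl

@[simp]
theorem cost_bind {α β : Type u} (x : Counted α) (f : α → Counted β) :
    (x >>= f).cost = x.cost + (f x.val).cost :=
  rfl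

theorem cost_bind_le {α β : Type u} {x : Counted α} {f : α → Counted β} {c d : OpCount}
    (hx : x.cost ≤ c) (hf : ∀ v, (f v).cost ≤ d) : (x >>= f).cost ≤ c + d :=
  OpCount.add_le_add hx (hf _)

theorem cost_downTo_le {σ : Type*} {f : ℕ → σ → Counted σ} {c : OpCount}
    (hf : ∀ i s, (f i s).cost ≤ c) (k : ℕ) (s : σ) : (downTo k f s).cost ≤ c.times k := by
  induction k generalizing s with
  | zero => exact OpCount.zero_le _
  | succ k ih =>
    refine OpCount.le_trans (cost_bind_le (hf k s) ih) ?_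
    refine ⟨?_, ?_, ?_, ?_, ?_, ?_⟩ <;> refine Nat.le_of_eq ?_ <;>
      exact (Nat.succ_mul _ _).trans (Nat.add_comm _ _) |>.symm

theorem downTo_invariant {σ : Type*} {f : ℕ → σ → Counted σ} (I : ℕ → σ → Prop)
    (hf : ∀ i s, I (i + 1) s → I i (f i s).val) (k : ℕ) (s : σ) (hs : I k s) :
    I 0 (downTo k f s).val := by
  induction k generalizing s with
  | zero => exact hs
  | succ k ih => exact ih _ (hf k s hs)

end Counted

namespace Nat

theorem div_two_pow_eq (m i : ℕ) :
    m / 2 ^ i = 2 * (m / 2 ^ (i + 1)) + (m.testBit i).toNat := by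
  rw [Nat.toNat_testBit, pow_succ, ← Nat.div_div_eq_div_mul]
  omega

theorem div_two_pow_eq_testBit {m k : ℕ} (h : m < 2 ^ (k + 1)) :
    m / 2 ^ k = (m.testBit k).toNat := by
  rw [div_two_pow_eq, Nat.div_eq_of_lt h]
  omega

end Nat

namespace MontgomeryCurve

variable {F : Type*} [Field F] {E : MontgomeryCurve F}

open Point

theorem Represents.of_eq {p : F × F} {R R' : E.Point} (h : Represents p R.x) (e : R = R') :
    Represents p R'.x :=
  e ▸ h

@[simp]
theorem cost_mul (x y : F) : (mul x y).cost = { M := 1 } := rfl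

@[simp]
theorem cost_sqr (x : F) : (sqr x).cost = { S := 1 } := rfl

@[simp]
theorem cost_add (x y : F) : (add x y).cost = { a := 1 } := rfl

@[simp]
theorem cost_sub (x y : F) : (sub x y).cost = { a := 1 } := rfl

@[simp]
theorem cost_inv (x : F) : (inv x).cost = { I := 1 } := rfl

@[simp]
theorem cost_mulA (E : MontgomeryCurve F) (x : F) : (E.mulA x).cost = { mA := 1 } := rfl

@[simp]
theorem cost_mulA24 (E : MontgomeryCurve F) (x : F) : (E.mulA24 x).cost = { mA := 1 } := rfl

@[simp]
theorem cost_mulB (E : MontgomeryCurve F) (x : F) : (E.mulB x).cost = { mB := 1 } := rfl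

@[simp]
theorem cost_xDBL (E : MontgomeryCurve F) (p : F × F) :
    (E.xDBL p).cost = { M := 2, S := 2, mA := 1, a := 4 } := by
  simp [xDBL]

@[simp]
theorem cost_xDBLgen (E : MontgomeryCurve F) (p : F × F) :
    (E.xDBLgen p).cost = { M := 3, S := 2, a := 4 } := by
  simp [xDBLgen]

variable [DecidableEq F]

theorem cost_xDBLADD_le (E : MontgomeryCurve F) (p q : F × F) (δ : Option F) :
    (E.xDBLADD p q δ).cost ≤ { M := 5, S := 4, mA := 1, a := 8 } := by
  rcases δ with _ | δ
  · simp [xDBLADD, OpCount.le_def]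
  · by_cases h : δ = 0 <;>
    simp [xDBLADD, h, OpCount.le_def]

theorem cost_xADD_le (E : MontgomeryCurve F) (p q : F × F) (δ : Option F) :
    (E.xADD p q δ).cost ≤ { M := 3, S := 2, a := 6 } := by
  rcases δ with _ | δ
  · simp [xADD, OpCount.le_def]
  · by_cases h : δ = 0 <;>
    simp [xADD, h, OpCount.le_def]

theorem cost_recover_le (E : MontgomeryCurve F) (P : Option (F × F)) (q r : F × F) :
    (E.recover P q r).cost ≤ { M := 12, S := 1, mA := 1, mB := 1, a := 8, I := 1 } := by
  rcases P with _ | ⟨x, y⟩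
  · exact OpCount.zero_le _
  by_cases hq : q.2 = 0
  · simp only [recover, if_pos hq]
    exact OpCount.zero_le _
  by_cases hr : r.2 = 0 <;>
  simp [recover, hq, hr, OpCount.le_def]

theorem cost_addSub_le (E : MontgomeryCurve F) (P Q : Option (F × F)) :
    (E.addSub P Q).cost ≤ { M := 5, S := 2, a := 11, I := 1 } := by
  rcases P with _ | ⟨x₁, y₁⟩
  · exact OpCount.zero_le _
  rcases Q with _ | ⟨x₂, y₂⟩
  · exact OpCount.zero_le _
  by_cases hx : x₁ = x₂
  · by_cases hy : y₁ = y₂ <;>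
    simp [addSub, hx, hy, OpCount.le_def]
  · simp [addSub, hx, OpCount.le_def]

theorem cost_chainInit_le (E : MontgomeryCurve F) (xP xQ xs xd : Option F) (s t d : Bool) :
    (E.chainInit xP xQ xs xd s t d).cost ≤ { M := 5, S := 4, mA := 1, a := 8 } := by
  cases s <;> cases t <;> cases d <;>
    first | exact OpCount.zero_le _ | exact cost_xDBLADD_le _ _ _ _

theorem cost_chainStep_le (E : MontgomeryCurve F) (xP xQ xs xd : Option F)
    (c₁ c₂ c₃ c₄ : Bool) (T : Triple F) :
    (E.chainStep xP xQ xs xd c₁ c₂ c₃ c₄ T).cost ≤ { M := 8, S := 6, mA := 1, a := 14 } :=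
  OpCount.add_le_add (cost_xADD_le E _ _ _)
    (OpCount.add_le_add (cost_xDBLADD_le E _ _ _) (OpCount.zero_le 0))

/-! ### The Montgomery ladder -/

theorem uniform1_correct {P : E.Point} (hP : 2 • P ≠ 0) {m : ℕ} (hm : 0 < m) :
    (E.uniform1 m P.coords).val = (m • P).coords := by
  have hsize : m.size - 1 + 1 = m.size := Nat.sub_add_cancel (Nat.size_pos.mpr hm)
  have htop : m / 2 ^ (m.size - 1) = 1 := by
    have h₁ : 2 ^ (m.size - 1) ≤ m := Nat.lt_size.mp (by omega)
    have h₂ : m < 2 ^ (m.size - 1 + 1) := by rw [hsize]; exact Nat.lt_size_self m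
    rw [pow_succ] at h₂
    exact Nat.div_eq_of_lt_le (by omega) (by omega)
  -- Before the bit `i - 1` is processed, the ladder holds `[k]P` and `[k + 1]P` with `k = ⌊m / 2 ^ i⌋`
  have key := Counted.downTo_invariant
    (f := fun i (t : (F × F) × (F × F)) =>
      if m.testBit i then do
        let r ← E.xDBLADD t.2 t.1 P.x
        return (r.2, r.1)
      else
        E.xDBLADD t.1 t.2 P.x)
    (fun i t => Represents t.1 ((m / 2 ^ i) • P).x ∧ Represents t.2 ((m / 2 ^ i + 1) • P).x)
    (by
      rintro i t ⟨h₁, h₂⟩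
      rw [Nat.div_two_pow_eq m i]
      generalize m / 2 ^ (i + 1) = k at h₁ h₂
      cases m.testBit i
      · have h := xDBLADD_correct (δ := P.x) h₁ h₂ (by congr 1; module)
        exact ⟨h.1.of_eq (by simp only [Bool.toNat_false]; module),
          h.2.of_eq (by simp only [Bool.toNat_false]; module)⟩
      · have h := xDBLADD_correct (δ := P.x) h₂ h₁ (by rw [x_sub_comm]; congr 1; module)
        exact ⟨h.2.of_eq (by simp only [Bool.toNat_true]; module),
          h.1.of_eq (by simp only [Bool.toNat_true]; module)⟩)
    (m.size - 1) (lift P.x, (E.xDBL (lift P.x)).val)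
    (by
      rw [htop, one_smul, one_add_one_eq_two, two_smul]
      exact ⟨represents_lift _, xDBL_correct (represents_lift _)⟩)
  simp only [pow_zero, Nat.div_one] at key
  rw [add_smul, one_smul] at key
  exact recover_correct hP key.1 key.2

theorem cost_uniform1_le (E : MontgomeryCurve F) (P : Option (F × F)) {m : ℕ} (hm : 0 < m) :
    (E.uniform1 m P).cost ≤
      { M := 5 * m.size + 10, S := 4 * m.size + 2, mA := m.size + 1, mB := 1,
        a := 8 * m.size + 6, I := 1 } := by
  have hpos := Nat.size_pos.mpr hm
  refine OpCount.le_trans (Counted.cost_bind_le (OpCount.le_refl _) fun _ =>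
    Counted.cost_bind_le
      (Counted.cost_downTo_le (c := { M := 5, S := 4, mA := 1, a := 8 }) (fun i t => ?_) _ _)
      fun _ => cost_recover_le E _ _ _) ?_
  · cases m.testBit i <;> exact cost_xDBLADD_le E _ _ _
  · rw [cost_xDBL]
    simp only [OpCount.times, OpCount.mk_add_mk, OpCount.le_def]
    omega

end MontgomeryCurve

namespace MontgomeryCurve

variable {F : Type*} [Field F] {E : MontgomeryCurve F} [DecidableEq F]

open Point

/-! ### Bernstein's differential addition chain -/

/-- The state of the chain above the scalars `a` and `b`, whose parities are `α` and `β`. Among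
`[a + i]P ⊕ [b + j]Q` with `i, j ∈ {0, 1}`, the triple holds the `x`-coordinates of the element
with both coefficients odd, of the one with both coefficients even, and of one of the two with
coefficients of different parity; the bit `d` is the parity of its coefficient of `P`. -/
def ChainInvariant (P Q : E.Point) (a b : ℕ) (α β d : Bool) (T : Triple F) : Prop :=
  Represents T.odd ((a + (!α).toNat) • P + (b + (!β).toNat) • Q).x ∧
  Represents T.even ((a + α.toNat) • P + (b + β.toNat) • Q).x ∧
  Represents T.mixed ((a + (α ^^ d).toNat) • P + (b + (β ^^ !d).toNat) • Q).x

theorem ChainInvariant.chainStep_odd {P Q : E.Point} {a b : ℕ} {α β d : Bool} {T : Triple F}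
    (h : ChainInvariant P Q a b α β d T) :
    Represents (E.xADD T.odd T.even (if α ^^ β then (P - Q).x else (P + Q).x)).val
      ((2 * a + 1) • P + (2 * b + 1) • Q).x := by
  obtain ⟨hO, hE, -⟩ := h
  have key := xADD_correct hO hE
  have e : (if α ^^ β then (P - Q).x else (P + Q).x) =
      ((a + (!α).toNat) • P + (b + (!β).toNat) • Q - ((a + α.toNat) • P + (b + β.toNat) • Q)).x := by
    cases α <;> cases β <;>
      simp only [Bool.not_false, Bool.not_true, Bool.toNat_false, Bool.toNat_true, Bool.xor_self,
        Bool.xor_false, Bool.xor_true, ite_true, ite_false, Bool.false_eq_true] <;>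
      first
        | (congr 1; module)
        | (rw [x_sub_comm]; congr 1; module)
  rw [← e] at key
  refine key.of_eq ?_
  cases α <;> cases β <;>
    simp only [Bool.not_false, Bool.not_true, Bool.toNat_false, Bool.toNat_true] <;> module

/-- The component of a triple whose coefficients of `P` and `Q` have parities `u` and `v`. -/
def Triple.component (T : Triple F) : Bool → Bool → F × F
  | true, true => T.odd
  | false, false => T.even
  | _, _ => T.mixed

theorem ChainInvariant.represents {P Q : E.Point} {a b : ℕ} {α β d : Bool} {T : Triple F}
    (h : ChainInvariant P Q a b α β d T) {i j : Bool}
    (hij : (α ^^ i) = (β ^^ j) ∨ (α ^^ i) = d) :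
    Represents (T.component (α ^^ i) (β ^^ j)) ((a + i.toNat) • P + (b + j.toNat) • Q).x := by
  obtain ⟨hO, hE, hM⟩ := h
  cases α <;> cases β <;> cases d <;> cases i <;> cases j <;>
    first
      | exact hO
      | exact hE
      | exact hM
      | exact absurd hij (by decide)

theorem chainStep_val (E : MontgomeryCurve F) (xP xQ xs xd : Option F) (α β s t e : Bool)
    (T : Triple F) :
    (E.chainStep xP xQ xs xd (α ^^ β) (s ^^ α) (t ^^ β) e T).val =
      { odd := (E.xADD T.odd T.even (if α ^^ β then xd else xs)).val
        even := (E.xDBLADD (T.component (α ^^ s) (β ^^ t))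
          (T.component (α ^^ (s ^^ e)) (β ^^ (t ^^ !e))) (if e then xP else xQ)).val.1
        mixed := (E.xDBLADD (T.component (α ^^ s) (β ^^ t))
          (T.component (α ^^ (s ^^ e)) (β ^^ (t ^^ !e))) (if e then xP else xQ)).val.2 } := by
  cases α <;> cases β <;> cases s <;> cases t <;> cases e <;> rfl

/-- One step of the chain appends the bits `s` and `t` to the scalars. With `e` the new last bit,
the element `U = [a + s]P ⊕ [b + t]Q`, which is doubled, and the element `V` that differs from it
in the coefficient selected by `e` both belong to the old triple exactly because the old last bit
is the one prescribed by the recursion of `chainBit`. -/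
theorem ChainInvariant.chainStep {P Q : E.Point} {a b : ℕ} {α β s t e : Bool} {T : Triple F}
    (h : ChainInvariant P Q a b α β (((!e) && (s ^^ α)) ^^ (e && !(t ^^ β))) T) :
    ChainInvariant P Q (2 * a + s.toNat) (2 * b + t.toNat) s t e
      (E.chainStep P.x Q.x (P + Q).x (P - Q).x (α ^^ β) (s ^^ α) (t ^^ β) e T).val := by
  have hO := h.chainStep_odd
  have hU := h.represents (i := s) (j := t)
    (by cases α <;> cases β <;> cases s <;> cases t <;> cases e <;> decide)
  have hV := h.represents (i := s ^^ e) (j := t ^^ !e)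
    (by cases α <;> cases β <;> cases s <;> cases t <;> cases e <;> decide)
  have hsum : ∀ u : Bool, u.toNat + (!u).toNat = 1 := by decide
  have hδ : (if e then P.x else Q.x) =
      ((a + (s ^^ e).toNat) • P + (b + (t ^^ !e).toNat) • Q -
        ((a + s.toNat) • P + (b + t.toNat) • Q)).x := by
    cases e <;>
      simp only [Bool.not_false, Bool.not_true, Bool.xor_false, Bool.xor_true, ite_true, ite_false,
        Bool.false_eq_true]
    · cases t
      · congr 1
        simp only [Bool.not_false, Bool.toNat_false, Bool.toNat_true]
        module
      · rw [x_sub_comm]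
        congr 1
        simp only [Bool.not_true, Bool.toNat_false, Bool.toNat_true]
        module
    · cases s
      · congr 1
        simp only [Bool.not_false, Bool.toNat_false, Bool.toNat_true]
        module
      · rw [x_sub_comm]
        congr 1
        simp only [Bool.not_true, Bool.toNat_false, Bool.toNat_true]
        module
  have hEM := xDBLADD_correct hU hV hδ
  rw [chainStep_val]
  refine ⟨?_, hEM.1.of_eq (by module), hEM.2.of_eq (by module)⟩
  rw [add_assoc, add_assoc, hsum, hsum]
  exact hO

theorem ChainInvariant.chainInit {P Q : E.Point} (s t d : Bool) (hst : s ∨ t) :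
    ChainInvariant P Q s.toNat t.toNat s t d
      (E.chainInit P.x Q.x (P + Q).x (P - Q).x s t d).val := by
  have hP := represents_lift P.x
  have hQ := represents_lift Q.x
  have hS := represents_lift (P + Q).x
  cases s <;> cases t
  · simp at hst
  · cases d
    · have h := xDBLADD_correct hQ hP rfl
      exact ⟨h.2.of_eq (by simp; module), h.1.of_eq (by simp; module), hQ.of_eq (by simp)⟩
    · have h := xDBLADD_correct (δ := P.x) hQ hS (by congr 1; module)
      exact ⟨hS.of_eq (by simp), h.1.of_eq (by simp; module), h.2.of_eq (by simp; module)⟩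
  · cases d
    · have h := xDBLADD_correct (δ := Q.x) hP hS (by congr 1; module)
      exact ⟨hS.of_eq (by simp), h.1.of_eq (by simp; module), h.2.of_eq (by simp; module)⟩
    · have h := xDBLADD_correct hP hQ (x_sub_comm P Q)
      exact ⟨h.2.of_eq (by simp), h.1.of_eq (by simp; module), hP.of_eq (by simp)⟩
  · cases d
    · have h := xDBLADD_correct (δ := Q.x) hS hP (by rw [x_sub_comm]; congr 1; module)
      exact ⟨hS.of_eq (by simp), h.1.of_eq (by simp; module), h.2.of_eq (by simp; module)⟩
    · have h := xDBLADD_correct (δ := P.x) hS hQ (by rw [x_sub_comm]; congr 1; module)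
      exact ⟨hS.of_eq (by simp), h.1.of_eq (by simp; module), h.2.of_eq (by simp; module)⟩

/-- The final recovery. Two of the components differ by `P` or by `P ⊕ Q`, according to the
parities of the scalars, and the first of them is the required combination. -/
theorem ChainInvariant.recover_correct {P Q : E.Point} {a b : ℕ} {α β : Bool} {T : Triple F}
    (h : ChainInvariant P Q a b α β α T) (hP : 2 • P ≠ 0) (hPQ : α = β → 2 • (P + Q) ≠ 0) :
    (match α, β with
      | false, false => E.recover (P + Q).coords T.even T.odd
      | false, true => E.recover P.coords T.mixed T.odd
      | true, false => E.recover P.coords T.mixed T.even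
      | true, true => E.recover (P + Q).coords T.odd T.even).val = (a • P + b • Q).coords := by
  obtain ⟨hO, hE, hM⟩ := h
  cases α <;> cases β
  · exact MontgomeryCurve.recover_correct (hPQ rfl) (hE.of_eq (by simp))
      (hO.of_eq (by simp; module))
  · exact MontgomeryCurve.recover_correct hP (hM.of_eq (by simp)) (hO.of_eq (by simp; module))
  · exact MontgomeryCurve.recover_correct hP (hM.of_eq (by simp)) (hE.of_eq (by simp; module))
  · exact MontgomeryCurve.recover_correct (hPQ rfl) (hO.of_eq (by simp))
      (hE.of_eq (by simp; module))

theorem uniform2_correct {P Q : E.Point} {m n : ℕ} (hP : 2 • P ≠ 0) (hQ : 2 • Q ≠ 0)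
    (hPQ : m ≡ n [MOD 2] → 2 • (P + Q) ≠ 0) (hm : 0 < m) :
    (E.uniform2 m n P.coords Q.coords).val = (m • P + n • Q).coords := by
  have hpos : 0 < (max m n).size := Nat.size_pos.mpr (lt_max_of_lt_left hm)
  obtain ⟨k, hk⟩ : ∃ k, (max m n).size = k + 1 := ⟨_, (Nat.sub_add_cancel hpos).symm⟩
  have hlt : max m n < 2 ^ (k + 1) := hk ▸ Nat.lt_size_self _
  have hle : 2 ^ k ≤ max m n := Nat.lt_size.mp (by omega)
  have hmk := Nat.div_two_pow_eq_testBit ((le_max_left m n).trans_lt hlt)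
  have hnk := Nat.div_two_pow_eq_testBit ((le_max_right m n).trans_lt hlt)
  have htop : m.testBit k ∨ n.testBit k := by
    rcases le_max_iff.mp hle with h | h
    · left
      have : 0 < m / 2 ^ k := Nat.div_pos h (by positivity)
      rw [hmk] at this
      revert this
      cases m.testBit k <;> decide
    · right
      have : 0 < n / 2 ^ k := Nat.div_pos h (by positivity)
      rw [hnk] at this
      revert this
      cases n.testBit k <;> decide
  have key := Counted.downTo_invariant
    (f := fun i T => E.chainStep P.x Q.x (P + Q).x (P - Q).x
      (m.testBit (i + 1) ^^ n.testBit (i + 1)) (m.testBit i ^^ m.testBit (i + 1))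
      (n.testBit i ^^ n.testBit (i + 1)) (chainBit m n i) T)
    (fun i T => ChainInvariant P Q (m / 2 ^ i) (n / 2 ^ i) (m.testBit i) (n.testBit i)
      (chainBit m n i) T)
    (fun i T h => by
      rw [Nat.div_two_pow_eq m i, Nat.div_two_pow_eq n i]
      exact ChainInvariant.chainStep h)
    k (E.chainInit P.x Q.x (P + Q).x (P - Q).x (m.testBit k) (n.testBit k) (chainBit m n k)).val
    (by
      rw [hmk, hnk]
      exact ChainInvariant.chainInit _ _ _ htop)
  simp only [pow_zero, Nat.div_one] at key
  have hmod : m.testBit 0 = n.testBit 0 → 2 • (P + Q) ≠ 0 := by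
    intro h
    apply hPQ
    simp only [Nat.testBit_zero, decide_eq_decide] at h
    unfold Nat.ModEq
    omega
  rw [uniform2]
  simp only [Counted.val_bind, addSub_correct hP hQ, hk, Nat.add_sub_cancel]
  exact key.recover_correct hP hmod

theorem cost_uniform2_le (E : MontgomeryCurve F) (P Q : Option (F × F)) {m n : ℕ} (hm : 0 < m) :
    (E.uniform2 m n P Q).cost ≤
      { M := 8 * (max m n).size + 14, S := 6 * (max m n).size + 2, mA := (max m n).size + 1,
        mB := 1, a := 14 * (max m n).size + 13, I := 2 } := by
  have hpos : 0 < (max m n).size := Nat.size_pos.mpr (lt_max_of_lt_left hm)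
  refine OpCount.le_trans (Counted.cost_bind_le (cost_addSub_le E P Q) fun _ =>
    Counted.cost_bind_le (cost_chainInit_le E _ _ _ _ _ _ _) fun _ =>
    Counted.cost_bind_le
      (Counted.cost_downTo_le (fun i t => cost_chainStep_le E _ _ _ _ _ _ _ _ _) _ _)
      (d := { M := 12, S := 1, mA := 1, mB := 1, a := 8, I := 1 }) fun _ => ?_) ?_
  · split <;> exact cost_recover_le E _ _ _
  · simp only [OpCount.times, OpCount.mk_add_mk, OpCount.le_def]
    omega

end MontgomeryCurve

/-! ### The two scalar multiplications -/

theorem mainTheorem4 {F : Type*} [Field F] [Finite F] [DecidableEq F] (E : MontgomeryCurve F) :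
    (∀ (P : E.Point) (m β : ℕ), 2 • P ≠ 0 → 0 < m → m.size = β →
      (E.uniform1 m P.coords).val = (m • P).coords ∧
      (E.uniform1 m P.coords).cost ≤
        { M := 5 * β + 10, S := 4 * β + 2, mA := β + 1, mB := 1, a := 8 * β + 6, I := 1 }) ∧
    (∀ (P Q : E.Point) (m n β : ℕ), 2 • P ≠ 0 → 2 • Q ≠ 0 →
      (m ≡ n [MOD 2] → 2 • (P + Q) ≠ 0) →
      0 < m → 0 < n → (max m n).size = β →
      (E.uniform2 m n P.coords Q.coords).val = (m • P + n • Q).coords ∧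
      (E.uniform2 m n P.coords Q.coords).cost ≤
        { M := 8 * β + 14, S := 6 * β + 2, mA := β + 1, mB := 1, a := 14 * β + 13, I := 2 }) := by
  refine ⟨?_, ?_⟩
  · rintro P m _ hP hm rfl
    exact ⟨MontgomeryCurve.uniform1_correct hP hm, MontgomeryCurve.cost_uniform1_le E _ hm⟩
  · rintro P Q m n _ hP hQ hPQ hm - rfl
    exact ⟨MontgomeryCurve.uniform2_correct hP hQ hPQ hm, MontgomeryCurve.cost_uniform2_le E _ _ hm⟩
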